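/- Theorem. There are a single algorithm $\mathcal A$ and a constant $C$ such that the following holds for every nonempty finite width-extensible poset $P=(X,<)$. Let $n$ be the width of $P$ (the size of a largest antichain); call an antichain of size $n$ a *width-antichain*; $P$ is *width-extensible* if every antichain of $P$ is contained in a width-antichain. Let $L$ be the number of width-antichains of $P$, i.e. the size of the lattice of width-antichains. Suppose that $P$ is given, in random access memory, by its comparability matrix (with respect to an arbitrary numbering of $X$) and by an arbitrary partition of $X$ into $n$ chains, each listed in increasing order (the states $[i,r]$ of the $n$ processes). Then $\mathcal A$ halts on this input after at most $C\,n^2L$ steps, and its output lists all width-antichains of $P$, each exactly once. Steps are counted on a unit-cost random access machine whose elementary instructions are: assigning a constant or another register to a register, adding or subtracting $1$, reading or writing a cell of a (two-dimensional) array addressed by registers, branching on $r_x<r_y$, and outputting the content of a register. The matrix and the chains already stand in memory at the start, so only accesses to them are charged. -/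

import Mathlib

universe u

/-! ### Width, width-antichains, width-extensible posets -/

section Poset

variable (X : Type u) [PartialOrder X] [Fintype X]

open Classical in
/-- The width of a finite poset: the size of a largest antichain. -/
noncomputable def posetWidth : ℕ :=
  (Finset.univ.filter fun A : Finset X => IsAntichain (· ≤ ·) (A : Set X)).sup Finset.card

variable {X} in
/-- A width-antichain is an antichain whose size is the width of the poset. -/
def IsWidthAntichain (A : Finset X) : Prop :=
  IsAntichain (· ≤ ·) (A : Set X) ∧ A.card = posetWidth X

/-- A finite poset is width-extensible if every antichain is contained in a width-antichain. -/
def WidthExtensible : Prop :=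
  ∀ A : Finset X, IsAntichain (· ≤ ·) (A : Set X) → ∃ W : Finset X, IsWidthAntichain W ∧ A ⊆ W

/-- The size of the lattice of width-antichains. -/
noncomputable def numWidthAntichains : ℕ :=
  Nat.card {A : Finset X // IsWidthAntichain A}

end Poset

/-- A partition of a poset into `n` chains (the processes), the elements of each chain being
listed in increasing order: `state i r` is the `r`-th element of the `i`-th chain. -/
structure ChainPartition (X : Type u) [PartialOrder X] (n : ℕ) where
  len : Fin n → ℕ
  state : (i : Fin n) → Fin (len i) → X
  strictMono : ∀ i, StrictMono (state i)
  bijective : Function.Bijective (fun p : (i : Fin n) × Fin (len i) => state p.1 p.2)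

/-! ### The machine model

A unit-cost random access machine, programmed by structured programs. It has registers
`r 0, r 1, …` and two-dimensional arrays `A 0, A 1, …`, all holding natural numbers, and a
write-only output stream. A program mentions only finitely many registers and arrays. An array
cell is addressed by the contents of two registers. The arithmetic is limited to adding and
subtracting one, so a value never exceeds the largest constant of the program or value of the
input by more than the number of steps made: the unit cost hides no large words. -/

/-- Programs. -/
inductive RamProg : Type
  /-- do nothing -/
  | skip : RamProg
  /-- `r x := k` for a constant `k` -/
  | const (x k : ℕ) : RamProg
  /-- `r x := r y` -/
  | copy (x y : ℕ) : RamProg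
  /-- `r x := r x + 1` -/
  | incr (x : ℕ) : RamProg
  /-- `r x := r x - 1` (and `0` stays `0`) -/
  | decr (x : ℕ) : RamProg
  /-- `r x := A a [r i] [r j]` -/
  | load (x a i j : ℕ) : RamProg
  /-- `A a [r i] [r j] := r x` -/
  | store (a i j x : ℕ) : RamProg
  /-- append `r x` to the output -/
  | emit (x : ℕ) : RamProg
  /-- first `p`, then `q` -/
  | seq (p q : RamProg) : RamProg
  /-- if `r x < r y` then `p` else `q` -/
  | ifLt (x y : ℕ) (p q : RamProg) : RamProg
  /-- while `r x < r y` do `p` -/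
  | whileLt (x y : ℕ) (p : RamProg) : RamProg

/-- Memory contents, together with the output produced so far. -/
structure RamState : Type where
  reg : ℕ → ℕ
  arr : ℕ → ℕ → ℕ → ℕ
  out : List ℕ

/-- Register assignment. -/
def RamState.setReg (s : RamState) (x v : ℕ) : RamState :=
  { s with reg := Function.update s.reg x v }

/-- Assignment to an array cell. -/
def RamState.setArr (s : RamState) (a i j v : ℕ) : RamState :=
  { s with arr := fun b k l => if b = a ∧ k = i ∧ l = j then v else s.arr b k l }

/-- `RamExec p s t k`: started in `s`, the program `p` halts in `t` after exactly `k` steps.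
Every elementary instruction and every evaluation of a test is one step. -/
inductive RamExec : RamProg → RamState → RamState → ℕ → Prop
  | skip (s : RamState) : RamExec .skip s s 1
  | const (s : RamState) (x k : ℕ) : RamExec (.const x k) s (s.setReg x k) 1
  | copy (s : RamState) (x y : ℕ) : RamExec (.copy x y) s (s.setReg x (s.reg y)) 1
  | incr (s : RamState) (x : ℕ) : RamExec (.incr x) s (s.setReg x (s.reg x + 1)) 1
  | decr (s : RamState) (x : ℕ) : RamExec (.decr x) s (s.setReg x (s.reg x - 1)) 1
  | load (s : RamState) (x a i j : ℕ) :
      RamExec (.load x a i j) s (s.setReg x (s.arr a (s.reg i) (s.reg j))) 1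
  | store (s : RamState) (a i j x : ℕ) :
      RamExec (.store a i j x) s (s.setArr a (s.reg i) (s.reg j) (s.reg x)) 1
  | emit (s : RamState) (x : ℕ) :
      RamExec (.emit x) s { s with out := s.out ++ [s.reg x] } 1
  | seq {p q : RamProg} {s s' s'' : RamState} {k l : ℕ}
      (hp : RamExec p s s' k) (hq : RamExec q s' s'' l) : RamExec (.seq p q) s s'' (k + l)
  | ifTrue {x y : ℕ} {p q : RamProg} {s s' : RamState} {k : ℕ}
      (h : s.reg x < s.reg y) (hp : RamExec p s s' k) : RamExec (.ifLt x y p q) s s' (k + 1)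
  | ifFalse {x y : ℕ} {p q : RamProg} {s s' : RamState} {k : ℕ}
      (h : ¬ s.reg x < s.reg y) (hq : RamExec q s s' k) : RamExec (.ifLt x y p q) s s' (k + 1)
  | whileTrue {x y : ℕ} {p : RamProg} {s s' s'' : RamState} {k l : ℕ}
      (h : s.reg x < s.reg y) (hp : RamExec p s s' k)
      (hw : RamExec (.whileLt x y p) s' s'' l) : RamExec (.whileLt x y p) s s'' (k + l + 1)
  | whileFalse {x y : ℕ} {p : RamProg} {s : RamState}
      (h : ¬ s.reg x < s.reg y) : RamExec (.whileLt x y p) s s 1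

/-- The final state and the number of steps are determined by the program and the initial
state. -/
theorem RamExec.deterministic {p : RamProg} {s t t' : RamState} {k k' : ℕ}
    (h : RamExec p s t k) (h' : RamExec p s t' k') : t = t' ∧ k = k' := by
  induction h generalizing t' k' with
  | seq hp hq ihp ihq =>
    cases h' with
    | seq hp' hq' =>
      obtain ⟨rfl, rfl⟩ := ihp hp'
      obtain ⟨rfl, rfl⟩ := ihq hq'
      exact ⟨rfl, rfl⟩
  | ifTrue hc hp ih =>
    cases h' with
    | ifTrue _ hp' => obtain ⟨rfl, rfl⟩ := ih hp'; exact ⟨rfl, rfl⟩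
    | ifFalse hc' _ => exact absurd hc hc'
  | ifFalse hc hp ih =>
    cases h' with
    | ifTrue hc' _ => exact absurd hc' hc
    | ifFalse _ hp' => obtain ⟨rfl, rfl⟩ := ih hp'; exact ⟨rfl, rfl⟩
  | whileTrue hc hp hw ihp ihw =>
    cases h' with
    | whileTrue _ hp' hw' =>
      obtain ⟨rfl, rfl⟩ := ihp hp'
      obtain ⟨rfl, rfl⟩ := ihw hw'
      exact ⟨rfl, rfl⟩
    | whileFalse hc' => exact absurd hc hc'
  | whileFalse hc =>
    cases h' with
    | whileTrue hc' _ _ => exact absurd hc' hc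
    | whileFalse _ => exact ⟨rfl, rfl⟩
  | _ => cases h'; exact ⟨rfl, rfl⟩

/-! ### Input and output -/

section InputOutput

variable {X : Type u} [PartialOrder X] [Fintype X]

open Classical in
/-- The input of the machine, for a poset whose elements are numbered `0, …, m - 1` by `num` and
which comes with a partition into `n` chains. Register `0` holds `n` and register `1` holds `m`;
array `0` holds at `[i][r]` the number of the `r`-th element of the `i`-th chain; array `1` is the
comparability matrix, with `1` at `[a][b]` if element `a` is less than element `b` and `0`
otherwise; array `2` holds at `[i][0]` the length of the `i`-th chain. All other cells hold `0` and
nothing has been output. -/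
noncomputable def ramInput (num : X ≃ Fin (Fintype.card X)) {n : ℕ} (P : ChainPartition X n) :
    RamState where
  reg x := if x = 0 then n else if x = 1 then Fintype.card X else 0
  arr a i j :=
    if a = 0 then
      if hi : i < n then
        if hj : j < P.len ⟨i, hi⟩ then (num (P.state ⟨i, hi⟩ ⟨j, hj⟩) : ℕ) else 0
      else 0
    else if a = 1 then
      if h : i < Fintype.card X ∧ j < Fintype.card X then
        if num.symm ⟨i, h.1⟩ < num.symm ⟨j, h.2⟩ then 1 else 0
      else 0
    else if a = 2 then
      if h : i < n ∧ j = 0 then P.len ⟨i, h.1⟩ else 0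
    else 0
  out := []

open Classical in
/-- The output `out` enumerates the width-antichains: it is a concatenation of blocks, each
listing the numbers of the elements of one width-antichain without repetition, and every
width-antichain is listed by exactly one block. (All blocks have length `posetWidth X`, so `out`
determines them.) -/
def EnumeratesWidthAntichains (num : X ≃ Fin (Fintype.card X)) (out : List ℕ) : Prop :=
  ∃ blocks : List (List X),
    out = blocks.flatten.map (fun x => (num x : ℕ)) ∧
    (∀ b ∈ blocks, b.Nodup) ∧
    (blocks.map List.toFinset).Nodup ∧
    ∀ A : Finset X, A ∈ blocks.map List.toFinset ↔ IsWidthAntichain A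

end InputOutput

/-!
Every width-antichain contains exactly one element of each of the `n` chains, so it is a vector of
positions. Cut such a vector off after `k` entries: the remaining elements still form an
antichain, and, conversely, width-extensibility says that every antichain with one element in each
of the first `k` chains can be prolonged to the next chain (`ExtensibleChains.extend`). Therefore a
lexicographic enumeration of the vectors never meets a dead end.

Given compatible positions in the first `k` chains, the least compatible position in chain `k` is
the maximum of the positions at which chain `k` ceases to be below one of the elements chosen
so far (`IsPartial.update_minPos`): some compatible position exists, it is at least this maximum,
and an earlier element of chain `k` is not above a chosen one if a later element is not. With these
first positions in a table, one entry of a vector is filled in with its least value in `O(n)` steps.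
The next position in chain `k` is compatible as soon as it exists and is not above a chosen element
(`IsPartial.update_succ`), which also takes `O(n)` steps to test; and if it is not compatible, no
later one is (`lexLe_succ_iff_of_blocked`). So the lexicographic successor of a vector costs
`O(n ^ 2)` steps: increment the last entry that can be incremented and refill the entries after it.

The table has a column for each chain, and the positions in chain `j` belonging to the elements of
chain `i` increase along chain `i`. Hence one pass over both chains finds them all, and as every
element lies in some width-antichain, and distinct elements of a chain in distinct ones, a chain has
at most `L` elements (`ChainPartition.len_le_numWidthAntichains`). Thus the table costs
`O(n ^ 2 L)` steps as well.

For the verification, `Runs` describes a program by a postcondition on its final state and on its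
number of steps. The set of vectors already listed is always an initial segment of the
lexicographic order (`ExtensibleChains.Lists`), and each phase of the program changes only the
description of this segment.
-/

/-! ### Running programs -/

/-- Started in `s`, the program `p` halts, and the final state and the number of steps satisfy
`Q`. -/
def Runs (p : RamProg) (s : RamState) (Q : RamState → ℕ → Prop) : Prop :=
  ∃ t k, RamExec p s t k ∧ Q t k

namespace RamState

variable (s : RamState) (x y v a i j b k l : ℕ)

@[simp] theorem reg_setReg : (s.setReg x v).reg y = if y = x then v else s.reg y := by
  simp [setReg, Function.update_apply]

@[simp] theorem arr_setReg : (s.setReg x v).arr = s.arr := rfl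

@[simp] theorem out_setReg : (s.setReg x v).out = s.out := rfl

@[simp] theorem reg_setArr : (s.setArr a i j v).reg = s.reg := rfl

@[simp] theorem arr_setArr : (s.setArr a i j v).arr b k l =
    if b = a ∧ k = i ∧ l = j then v else s.arr b k l := rfl

@[simp] theorem out_setArr : (s.setArr a i j v).out = s.out := rfl

end RamState

/-- The states `s` and `t` have the same registers except possibly those in `L`. -/
def RamState.EqOff (L : List ℕ) (s t : RamState) : Prop := ∀ x ∉ L, t.reg x = s.reg x

namespace RamState.EqOff

variable {L : List ℕ} {s t u : RamState} {x v a i j : ℕ}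

theorem refl (L : List ℕ) (s : RamState) : EqOff L s s := fun _ _ => rfl

@[simp] theorem setReg_iff (hx : x ∈ L) : EqOff L s (t.setReg x v) ↔ EqOff L s t := by
  refine forall₂_congr fun y hy => ?_
  rw [reg_setReg, if_neg]
  rintro rfl
  exact hy hx

@[simp] theorem setArr_iff : EqOff L s (t.setArr a i j v) ↔ EqOff L s t := Iff.rfl

end RamState.EqOff

namespace Runs

variable {p q : RamProg} {s : RamState} {Q R : RamState → ℕ → Prop} {x y a i j k : ℕ}

theorem mono (h : Runs p s Q) (hQ : ∀ t k, Q t k → R t k) : Runs p s R := by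
  obtain ⟨t, k, he, hq⟩ := h
  exact ⟨t, k, he, hQ t k hq⟩

theorem seq_intro (h : Runs p s fun t k => Runs q t fun u l => Q u (k + l)) :
    Runs (.seq p q) s Q := by
  obtain ⟨t, k, he, u, l, he', hq⟩ := h
  exact ⟨u, k + l, .seq he he', hq⟩

@[simp] theorem seq_iff :
    Runs (.seq p q) s Q ↔ Runs p s fun t k => Runs q t fun u l => Q u (k + l) := by
  refine ⟨?_, seq_intro⟩
  rintro ⟨u, k, he, hq⟩
  cases he with
  | seq h h' => exact ⟨_, _, h, _, _, h', hq⟩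

@[simp] theorem skip_iff : Runs .skip s Q ↔ Q s 1 :=
  ⟨by rintro ⟨_, _, he, hq⟩; cases he; exact hq, fun h => ⟨_, _, .skip s, h⟩⟩

@[simp] theorem const_iff : Runs (.const x k) s Q ↔ Q (s.setReg x k) 1 :=
  ⟨by rintro ⟨_, _, he, hq⟩; cases he; exact hq, fun h => ⟨_, _, .const s x k, h⟩⟩

@[simp] theorem copy_iff : Runs (.copy x y) s Q ↔ Q (s.setReg x (s.reg y)) 1 :=
  ⟨by rintro ⟨_, _, he, hq⟩; cases he; exact hq, fun h => ⟨_, _, .copy s x y, h⟩⟩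

@[simp] theorem incr_iff : Runs (.incr x) s Q ↔ Q (s.setReg x (s.reg x + 1)) 1 :=
  ⟨by rintro ⟨_, _, he, hq⟩; cases he; exact hq, fun h => ⟨_, _, .incr s x, h⟩⟩

@[simp] theorem decr_iff : Runs (.decr x) s Q ↔ Q (s.setReg x (s.reg x - 1)) 1 :=
  ⟨by rintro ⟨_, _, he, hq⟩; cases he; exact hq, fun h => ⟨_, _, .decr s x, h⟩⟩

@[simp] theorem load_iff :
    Runs (.load x a i j) s Q ↔ Q (s.setReg x (s.arr a (s.reg i) (s.reg j))) 1 :=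
  ⟨by rintro ⟨_, _, he, hq⟩; cases he; exact hq, fun h => ⟨_, _, .load s x a i j, h⟩⟩

@[simp] theorem store_iff :
    Runs (.store a i j x) s Q ↔ Q (s.setArr a (s.reg i) (s.reg j) (s.reg x)) 1 :=
  ⟨by rintro ⟨_, _, he, hq⟩; cases he; exact hq, fun h => ⟨_, _, .store s a i j x, h⟩⟩

@[simp] theorem emit_iff :
    Runs (.emit x) s Q ↔ Q { s with out := s.out ++ [s.reg x] } 1 :=
  ⟨by rintro ⟨_, _, he, hq⟩; cases he; exact hq, fun h => ⟨_, _, .emit s x, h⟩⟩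

theorem ifLt_true (h : s.reg x < s.reg y) (hp : Runs p s fun t k => Q t (k + 1)) :
    Runs (.ifLt x y p q) s Q := by
  obtain ⟨t, k, he, hq⟩ := hp
  exact ⟨t, k + 1, .ifTrue h he, hq⟩

theorem ifLt_false (h : ¬ s.reg x < s.reg y) (hp : Runs q s fun t k => Q t (k + 1)) :
    Runs (.ifLt x y p q) s Q := by
  obtain ⟨t, k, he, hq⟩ := hp
  exact ⟨t, k + 1, .ifFalse h he, hq⟩

/-- The rule for loops: an invariant indexed by a bound on the number of rounds still to come,
and a common bound `c` on the cost of a round, the test included. -/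
theorem whileLt_of_invariant (Inv : ℕ → RamState → Prop) (c : ℕ)
    (body : ∀ N s, Inv N s → s.reg x < s.reg y →
      Runs p s fun t k => k < c ∧ ∃ M < N, Inv M t) :
    ∀ N s, Inv N s → Runs (.whileLt x y p) s fun t k =>
      k ≤ N * c + 1 ∧ ¬ t.reg x < t.reg y ∧ ∃ M, Inv M t := by
  intro N
  induction N using Nat.strong_induction_on with
  | _ N ih =>
    intro s hs
    by_cases h : s.reg x < s.reg y
    · obtain ⟨t, k, he, hk, M, hM, ht⟩ := body N s hs h
      obtain ⟨u, l, he', hl, hu⟩ := ih M hM t ht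
      refine ⟨u, k + l + 1, .whileTrue h he he', ?_, hu⟩
      have : (M + 1) * c ≤ N * c := Nat.mul_le_mul_right _ hM
      rw [Nat.add_mul, Nat.one_mul] at this
      omega
    · exact ⟨s, 1, .whileFalse h, by omega, h, N, hs⟩

end Runs

/-! ### Position vectors and their lexicographic enumeration -/

/-- Chains `0, …, n - 1` in `X`, with numbers attached to the elements of `X`, such that one element
of each of the first `k` chains, if pairwise incomparable, can be prolonged to chain `k`. The element
at position `a` of chain `i` is `el i a`; the values at `i ≥ n` or `a ≥ len i` are irrelevant. -/
structure ExtensibleChains (X : Type u) [PartialOrder X] where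
  n : ℕ
  len : ℕ → ℕ
  el : ℕ → ℕ → X
  code : X → ℕ
  n_pos : 0 < n
  code_injective : Function.Injective code
  el_lt : ∀ i < n, ∀ a b, a < b → b < len i → el i a < el i b
  exists_not_lt : ∀ i < n, ∀ a < len i, ∀ j < n, ∃ b < len j, ¬ el j b < el i a
  extend : ∀ k < n, ∀ v : ℕ → ℕ,
    (∀ i < k, v i < len i ∧ ∀ j < k, ¬ el i (v i) < el j (v j)) →
    ∃ b < len k, ∀ i < k, ¬ el i (v i) < el k b ∧ ¬ el k b < el i (v i)

/-- The first `k` entries of `w` precede those of `v` lexicographically. -/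
def LexLt (k : ℕ) (w v : ℕ → ℕ) : Prop := ∃ j < k, w j < v j ∧ ∀ i < j, w i = v i

/-- The first `k` entries of `w` and `v` are the same. -/
def AgreeBelow (k : ℕ) (w v : ℕ → ℕ) : Prop := ∀ i < k, w i = v i

/-- The first `k` entries of `w` precede or equal those of `v`. -/
def LexLe (k : ℕ) (w v : ℕ → ℕ) : Prop := LexLt k w v ∨ AgreeBelow k w v

theorem AgreeBelow.succ_iff {k : ℕ} {w v : ℕ → ℕ} :
    AgreeBelow (k + 1) w v ↔ AgreeBelow k w v ∧ w k = v k := by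
  simp only [AgreeBelow, Nat.lt_succ_iff_lt_or_eq]
  constructor
  · exact fun h => ⟨fun i hi => h i (.inl hi), h k (.inr rfl)⟩
  · rintro ⟨h, h'⟩ i (hi | rfl)
    exacts [h i hi, h']

theorem LexLt.succ_iff {k : ℕ} {w v : ℕ → ℕ} :
    LexLt (k + 1) w v ↔ LexLt k w v ∨ AgreeBelow k w v ∧ w k < v k := by
  constructor
  · rintro ⟨j, hj, hlt, hag⟩
    rcases Nat.lt_succ_iff_lt_or_eq.1 hj with hj | rfl
    exacts [.inl ⟨j, hj, hlt, hag⟩, .inr ⟨hag, hlt⟩]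
  · rintro (⟨j, hj, h⟩ | ⟨hag, hlt⟩)
    exacts [⟨j, hj.trans k.lt_succ_self, h⟩, ⟨k, k.lt_succ_self, hlt, hag⟩]

theorem LexLe.succ_iff {k : ℕ} {w v : ℕ → ℕ} :
    LexLe (k + 1) w v ↔ LexLt k w v ∨ AgreeBelow k w v ∧ w k ≤ v k := by
  rw [LexLe, LexLt.succ_iff, AgreeBelow.succ_iff, le_iff_lt_or_eq]
  tauto

theorem LexLt.update_iff {k : ℕ} {w v : ℕ → ℕ} {b : ℕ} :
    LexLt k w (Function.update v k b) ↔ LexLt k w v := by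
  refine exists_congr fun j => and_congr_right fun hj => ?_
  rw [Function.update_of_ne hj.ne]
  refine and_congr_right fun _ => forall₂_congr fun i hi => ?_
  rw [Function.update_of_ne (hi.trans hj).ne]

theorem AgreeBelow.update_iff {k : ℕ} {w v : ℕ → ℕ} {b : ℕ} :
    AgreeBelow k w (Function.update v k b) ↔ AgreeBelow k w v :=
  forall₂_congr fun i hi => by rw [Function.update_of_ne hi.ne]

theorem LexLt.not_agreeBelow {k : ℕ} {w v : ℕ → ℕ} (h : LexLt k w v) : ¬ AgreeBelow k w v := by
  obtain ⟨j, hj, hlt, -⟩ := h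
  exact fun h' => hlt.ne (h' j hj)

section

variable {X : Type u} [PartialOrder X]

/-- The first index at which the sequence `c` is not below `x`. -/
noncomputable def firstNotBelow (c : ℕ → X) (x : X) : ℕ := sInf {r | ¬ c r < x}

theorem firstNotBelow_le {c : ℕ → X} {x : X} {r : ℕ} (h : ¬ c r < x) : firstNotBelow c x ≤ r :=
  Nat.sInf_le h

namespace ExtensibleChains

variable (D : ExtensibleChains X)

/-- The elements at positions `v 0, …, v (k - 1)` of the first `k` chains are pairwise
incomparable. -/
def IsPartial (k : ℕ) (v : ℕ → ℕ) : Prop :=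
  ∀ i < k, v i < D.len i ∧ ∀ j < k, ¬ D.el i (v i) < D.el j (v j)

variable {D} {k : ℕ} {v w : ℕ → ℕ}

theorem el_le {i a b : ℕ} (hi : i < D.n) (hab : a ≤ b) (hb : b < D.len i) :
    D.el i a ≤ D.el i b := by
  rcases hab.eq_or_lt with rfl | h
  exacts [le_rfl, (D.el_lt i hi a b h hb).le]

theorem firstNotBelow_lt_len {i a j : ℕ} (hi : i < D.n) (ha : a < D.len i) (hj : j < D.n) :
    firstNotBelow (D.el j) (D.el i a) < D.len j := by
  obtain ⟨b, hb, h⟩ := D.exists_not_lt i hi a ha j hj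
  exact (firstNotBelow_le h).trans_lt hb

theorem not_lt_firstNotBelow {i a j : ℕ} (hi : i < D.n) (ha : a < D.len i) (hj : j < D.n) :
    ¬ D.el j (firstNotBelow (D.el j) (D.el i a)) < D.el i a := by
  obtain ⟨b, hb, h⟩ := D.exists_not_lt i hi a ha j hj
  exact Nat.sInf_mem (s := {r | ¬ D.el j r < D.el i a}) ⟨b, h⟩

theorem IsPartial.mono {l : ℕ} (h : D.IsPartial k v) (hl : l ≤ k) : D.IsPartial l v :=
  fun i hi => ⟨(h i (hi.trans_le hl)).1, fun j hj => (h i (hi.trans_le hl)).2 j (hj.trans_le hl)⟩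

theorem IsPartial.update {b : ℕ} (h : D.IsPartial k v) (hb : b < D.len k)
    (hinc : ∀ i < k, ¬ D.el i (v i) < D.el k b ∧ ¬ D.el k b < D.el i (v i)) :
    D.IsPartial (k + 1) (Function.update v k b) := by
  intro i hi
  rcases Nat.lt_succ_iff_lt_or_eq.1 hi with hi | rfl
  · rw [Function.update_of_ne hi.ne]
    refine ⟨(h i hi).1, fun j hj => ?_⟩
    rcases Nat.lt_succ_iff_lt_or_eq.1 hj with hj | rfl
    · rw [Function.update_of_ne hj.ne]
      exact (h i hi).2 j hj
    · rw [Function.update_self]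
      exact (hinc i hi).1
  · rw [Function.update_self]
    refine ⟨hb, fun j hj => ?_⟩
    rcases Nat.lt_succ_iff_lt_or_eq.1 hj with hj | rfl
    · rw [Function.update_of_ne hj.ne]
      exact (hinc j hj).2
    · rw [Function.update_self]
      exact lt_irrefl _

variable (D) in
/-- The least position in chain `k` that is not below any of the elements at positions
`v 0, …, v (k - 1)` of the chains before it. -/
noncomputable def minPos (k : ℕ) (v : ℕ → ℕ) : ℕ :=
  (Finset.range k).sup fun i => firstNotBelow (D.el k) (D.el i (v i))

theorem minPos_le {b : ℕ} (h : ∀ i < k, ¬ D.el k b < D.el i (v i)) : D.minPos k v ≤ b :=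
  Finset.sup_le fun i hi => firstNotBelow_le (h i (Finset.mem_range.1 hi))

theorem IsPartial.minPos_le (hw : D.IsPartial (k + 1) w) (h : AgreeBelow k w v) :
    D.minPos k v ≤ w k :=
  ExtensibleChains.minPos_le fun i hi => by
    rw [← h i hi]
    exact (hw k k.lt_succ_self).2 i (hi.trans k.lt_succ_self)

/-- Some position `b` is compatible with `v`, by extensibility, and it is at least `minPos`. Hence
`minPos` is not above an element given by `v`, since `b` is not. -/
theorem IsPartial.update_minPos (hk : k < D.n) (h : D.IsPartial k v) :
    D.IsPartial (k + 1) (Function.update v k (D.minPos k v)) := by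
  obtain ⟨b, hb, hinc⟩ := D.extend k hk v h
  have hle : D.minPos k v ≤ b := ExtensibleChains.minPos_le fun i hi => (hinc i hi).2
  refine h.update (hle.trans_lt hb) fun i hi => ⟨fun hlt => ?_, fun hlt => ?_⟩
  · exact (hinc i hi).1 (hlt.trans_le (el_le hk hle hb))
  · have hf : firstNotBelow (D.el k) (D.el i (v i)) ≤ D.minPos k v :=
      Finset.le_sup (f := fun i => firstNotBelow (D.el k) (D.el i (v i)))
        (Finset.mem_range.2 hi)
    exact not_lt_firstNotBelow (hi.trans hk) (h i hi).1 hk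
      ((el_le hk hf (hle.trans_lt hb)).trans_lt hlt)

/-- The next position in the last chain is compatible with the earlier ones as soon as it is not
above any of them. -/
theorem IsPartial.update_succ (hk : k < D.n) (h : D.IsPartial (k + 1) v)
    (hb : v k + 1 < D.len k) (hinc : ∀ i < k, ¬ D.el i (v i) < D.el k (v k + 1)) :
    D.IsPartial (k + 1) (Function.update v k (v k + 1)) :=
  (h.mono k.le_succ).update hb fun i hi => ⟨hinc i hi, fun hlt =>
    (h k k.lt_succ_self).2 i (hi.trans k.lt_succ_self)
      ((el_le hk (v k).le_succ hb).trans_lt hlt)⟩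

/-- Filling in the least value leaves the set of preceding vectors unchanged. -/
theorem lexLt_update_minPos_iff (hk : k < D.n) (hw : D.IsPartial D.n w) :
    LexLt (k + 1) w (Function.update v k (D.minPos k v)) ↔ LexLt k w v := by
  rw [LexLt.succ_iff, LexLt.update_iff, AgreeBelow.update_iff, Function.update_self]
  refine or_iff_left fun ⟨h, hlt⟩ => ?_
  exact (IsPartial.minPos_le (hw.mono hk) h).not_gt hlt

theorem lexLt_update_succ_iff :
    LexLt (k + 1) w (Function.update v k (v k + 1)) ↔ LexLe (k + 1) w v := by
  rw [LexLt.succ_iff, LexLt.update_iff, AgreeBelow.update_iff, Function.update_self,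
    LexLe.succ_iff, Nat.lt_succ_iff]

/-- If the `k`-th entry of `v` cannot be incremented, then among the vectors that agree with `v`
before `k` none has a larger `k`-th entry. -/
theorem lexLe_succ_iff_of_blocked (hk : k < D.n) (hw : D.IsPartial D.n w)
    (hb : v k + 1 < D.len k → ∃ i < k, D.el i (v i) < D.el k (v k + 1)) :
    LexLe (k + 1) w v ↔ LexLe k w v := by
  rw [LexLe.succ_iff, LexLe]
  refine or_congr_right (and_iff_left_of_imp fun h => ?_)
  by_contra! hlt
  obtain ⟨i, hi, hlt'⟩ := hb (lt_of_le_of_lt hlt (hw k hk).1)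
  rw [← h i hi] at hlt'
  exact (hw i (hi.trans hk)).2 k hk (hlt'.trans_le (el_le hk hlt (hw k hk).1))

variable (D) in
/-- `ws` lists, in strictly increasing lexicographic order, the vectors of pairwise incomparable
positions in all chains that satisfy `S`. Only the first `n` entries of a vector matter, so every
vector is listed up to its other entries. -/
structure Lists (ws : List (ℕ → ℕ)) (S : (ℕ → ℕ) → Prop) : Prop where
  sorted : ws.Pairwise (LexLt D.n)
  valid : ∀ w ∈ ws, D.IsPartial D.n w ∧ S w
  complete : ∀ w, D.IsPartial D.n w → S w → ∃ w' ∈ ws, AgreeBelow D.n w' w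

variable {ws : List (ℕ → ℕ)} {S T : (ℕ → ℕ) → Prop}

theorem Lists.congr (h : D.Lists ws S) (hST : ∀ w, D.IsPartial D.n w → (T w ↔ S w)) :
    D.Lists ws T where
  sorted := h.sorted
  valid w hw := ⟨(h.valid w hw).1, (hST w (h.valid w hw).1).2 (h.valid w hw).2⟩
  complete w hw hT := h.complete w hw ((hST w hw).1 hT)

theorem Lists.concat (h : D.Lists ws fun w => LexLt D.n w v) (hv : D.IsPartial D.n v) :
    D.Lists (ws ++ [v]) fun w => LexLe D.n w v where
  sorted := by
    rw [List.pairwise_append]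
    refine ⟨h.sorted, List.pairwise_singleton _ _, fun w hw u hu => ?_⟩
    rw [List.mem_singleton.1 hu]
    exact (h.valid w hw).2
  valid w hw := by
    rcases List.mem_append.1 hw with hw | hw
    · exact ⟨(h.valid w hw).1, .inl (h.valid w hw).2⟩
    · rw [List.mem_singleton.1 hw]
      exact ⟨hv, .inr fun _ _ => rfl⟩
  complete w hw hS := by
    rcases hS with hlt | hag
    · obtain ⟨w', hw', ha⟩ := h.complete w hw hlt
      exact ⟨w', List.mem_append_left _ hw', ha⟩
    · exact ⟨v, by simp, fun i hi => (hag i hi).symm⟩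

end ExtensibleChains

end

/-! ### The program -/

/-- Sequential composition of programs. -/
local infixr:60 " ;; " => RamProg.seq

/-! The registers. `rI`, `rK` count chains, `rPos` and `rStop` positions. `rStop` also serves to end
the search for an entry to increment, and `rZero` is never written. -/

local notation "rN" => 0
local notation "rZero" => 2
local notation "rI" => 3
local notation "rK" => 4
local notation "rPos" => 5
local notation "rElt" => 6
local notation "rFlag" => 7
local notation "rStop" => 8
local notation "rLen" => 9
local notation "rOther" => 10
local notation "rBit" => 11

/-! The arrays. The first three are the input. `aFirst` at `[x][j]` is the first position in chain
`j` not below `x`; `aPos` and `aCur` at `[i][0]` are the current position in chain `i` and the number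
of the element there. -/

local notation "aElt" => 0
local notation "aLess" => 1
local notation "aLen" => 2
local notation "aFirst" => 3
local notation "aPos" => 4
local notation "aCur" => 5

namespace Enumeration

open RamProg

/-- For the chains `i` and `j` in `rI` and `rK`, fills in column `j` of `aFirst` for the elements of
chain `i`, by one simultaneous pass over both chains. -/
def rowProg : RamProg :=
  whileLt rStop rLen
    (load rElt aElt rI rStop ;;
     load rOther aElt rK rPos ;;
     load rFlag aLess rOther rElt ;;
     ifLt rZero rFlag (incr rPos) (store aFirst rElt rK rPos ;; incr rStop))

/-- Fills in the table `aFirst`. -/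
def tableProg : RamProg :=
  const rI 0 ;;
  whileLt rI rN
    (load rLen aLen rI rZero ;;
     const rK 0 ;;
     whileLt rK rN (const rStop 0 ;; const rPos 0 ;; rowProg ;; incr rK) ;;
     incr rI)

/-- Puts into `rPos` the least position in chain `rK` compatible with the current positions in
the chains before it. -/
def minPosProg : RamProg :=
  const rPos 0 ;;
  const rI 0 ;;
  whileLt rI rK
    (load rElt aCur rI rZero ;;
     load rFlag aFirst rElt rK ;;
     ifLt rPos rFlag (copy rPos rFlag) skip ;;
     incr rI)

/-- Makes `rPos` the current position in chain `rK` and goes on to the next chain. -/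
def placeProg : RamProg :=
  store aPos rK rZero rPos ;;
  load rElt aElt rK rPos ;;
  store aCur rK rZero rElt ;;
  incr rK

/-- Gives all chains from `rK` on their least compatible positions. -/
def fillProg : RamProg := whileLt rK rN (minPosProg ;; placeProg)

/-- Outputs the current elements of all chains. -/
def emitProg : RamProg :=
  const rI 0 ;;
  whileLt rI rN (load rElt aCur rI rZero ;; emit rElt ;; incr rI)

/-- Tests whether position `rPos` of chain `rK` is above a current element of an earlier chain. -/
def blockedProg : RamProg :=
  const rFlag 0 ;;
  const rI 0 ;;
  load rElt aElt rK rPos ;;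
  whileLt rI rK
    (load rOther aCur rI rZero ;;
     load rBit aLess rOther rElt ;;
     ifLt rZero rBit (const rFlag 1) skip ;;
     incr rI)

/-- Increments the last position that can be incremented, and leaves in `rK` the number of the
chains whose positions are kept. This is `0` if no position can be incremented. -/
def retreatProg : RamProg :=
  const rStop 0 ;;
  whileLt rStop rK
    (decr rK ;;
     load rPos aPos rK rZero ;;
     incr rPos ;;
     load rLen aLen rK rZero ;;
     ifLt rPos rLen blockedProg (const rFlag 1) ;;
     ifLt rZero rFlag skip (placeProg ;; copy rStop rK))

/-- Enumerates the width-antichains in lexicographic order. -/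
def enumProg : RamProg :=
  tableProg ;;
  const rPos 0 ;;
  const rK 0 ;;
  placeProg ;;
  whileLt rZero rK (fillProg ;; emitProg ;; retreatProg)

end Enumeration

/-! ### Memory contents -/

section

variable {X : Type u} [PartialOrder X]

namespace ExtensibleChains

variable (D : ExtensibleChains X)

/-- The input is in memory: the chains, the comparability matrix, the lengths and the number of the
chains. -/
structure Loaded (s : RamState) : Prop where
  regN : s.reg rN = D.n
  regZero : s.reg rZero = 0
  arrElt : ∀ i < D.n, ∀ a < D.len i, s.arr aElt i a = D.code (D.el i a)
  arrLess : ∀ x y, 0 < s.arr aLess (D.code x) (D.code y) ↔ x < y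
  arrLen : ∀ i < D.n, s.arr aLen i 0 = D.len i

/-- The entry of the table for the element `x` and chain `j` is correct. -/
def TableEntry (s : RamState) (x : X) (j : ℕ) : Prop :=
  s.arr aFirst (D.code x) j = firstNotBelow (D.el j) x

/-- The table is correct. -/
def Tabled (s : RamState) : Prop := ∀ i < D.n, ∀ a < D.len i, ∀ j < D.n,
  D.TableEntry s (D.el i a) j

/-- The current positions in the first `k` chains are those given by `v`. -/
def Holds (k : ℕ) (v : ℕ → ℕ) (s : RamState) : Prop :=
  ∀ i < k, s.arr aPos i 0 = v i ∧ s.arr aCur i 0 = D.code (D.el i (v i))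

/-- The input and the table are in memory, and `v` gives the current positions in the first `k`
chains. -/
structure Ready (k : ℕ) (v : ℕ → ℕ) (s : RamState) : Prop where
  loaded : D.Loaded s
  tabled : D.Tabled s
  holds : D.Holds k v s
  regK : s.reg rK = k

variable {D} {s t : RamState} {k : ℕ} {v : ℕ → ℕ}

theorem Loaded.of_eq (h : D.Loaded s) (h0 : t.reg rN = s.reg rN) (h2 : t.reg rZero = s.reg rZero)
    (ha : ∀ a < 3, t.arr a = s.arr a) : D.Loaded t where
  regN := h0.trans h.regN
  regZero := h2.trans h.regZero
  arrElt := by rw [ha 0 (by decide)]; exact h.arrElt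
  arrLess := by rw [ha 1 (by decide)]; exact h.arrLess
  arrLen := by rw [ha 2 (by decide)]; exact h.arrLen

@[simp] theorem tableEntry_setReg {x y u : ℕ} {z : X} :
    D.TableEntry (s.setReg x u) z y ↔ D.TableEntry s z y := Iff.rfl

theorem TableEntry.setArr {x y : X} {j l p : ℕ} (hp : p = firstNotBelow (D.el j) x)
    (h : y = x ∧ l = j ∨ D.TableEntry s y l) :
    D.TableEntry (s.setArr aFirst (D.code x) j p) y l := by
  by_cases hxy : y = x ∧ l = j
  · obtain ⟨rfl, rfl⟩ := hxy
    simp [TableEntry, hp]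
  · simpa [TableEntry, D.code_injective.eq_iff, hxy] using h.resolve_left hxy

theorem Holds.mono {l : ℕ} (h : D.Holds k v s) (hl : l ≤ k) : D.Holds l v s :=
  fun i hi => h i (hi.trans_le hl)

end ExtensibleChains

end

/-! ### Running times and effects of the parts of the program -/

namespace Enumeration

open RamProg ExtensibleChains RamState

variable {X : Type u} [PartialOrder X] {D : ExtensibleChains X} {s : RamState}
  {k : ℕ} {v : ℕ → ℕ}

/-- Every round advances the position in one of the two chains. The invariant says that the position
in chain `j` has not passed the entries still to be found, so it stays within the chain. -/
theorem row_runs {i j : ℕ} (hs : D.Loaded s) (hi : i < D.n) (hj : j < D.n)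
    (hI : s.reg rI = i) (hK : s.reg rK = j) (hLen : s.reg rLen = D.len i)
    (hStop : s.reg rStop = 0) (hPos : s.reg rPos = 0) :
    Runs rowProg s fun t c => c ≤ (D.len i + D.len j) * 7 + 1 ∧
      EqOff [rPos, rElt, rFlag, rStop, rOther] s t ∧ t.out = s.out ∧
      (∀ a ≠ aFirst, t.arr a = s.arr a) ∧ (∀ x l, D.TableEntry s x l → D.TableEntry t x l) ∧
      ∀ a < D.len i, D.TableEntry t (D.el i a) j := by
  refine (Runs.whileLt_of_invariant (fun N t => N + t.reg rStop + t.reg rPos = D.len i + D.len j ∧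
      EqOff [rPos, rElt, rFlag, rStop, rOther] s t ∧ t.out = s.out ∧
      (∀ a ≠ aFirst, t.arr a = s.arr a) ∧ (∀ x l, D.TableEntry s x l → D.TableEntry t x l) ∧
      (∀ a < t.reg rStop, D.TableEntry t (D.el i a) j) ∧
      ∀ a, t.reg rStop ≤ a → a < D.len i →
        t.reg rPos ≤ firstNotBelow (D.el j) (D.el i a)) 7 ?_
    (D.len i + D.len j) s ?_).mono ?_
  · rintro N t ⟨hN, hf, ho, ha, hold, hnew, hle⟩ hlt
    have hI' : t.reg rI = i := (hf _ (by decide)).trans hI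
    have hK' : t.reg rK = j := (hf _ (by decide)).trans hK
    have hlt' : t.reg rStop < D.len i := by
      rwa [hf rLen (by decide), hLen] at hlt
    have hZ : t.reg rZero = 0 := (hf _ (by decide)).trans hs.regZero
    have hp := hle _ le_rfl hlt'
    have hfl := firstNotBelow_lt_len hi hlt' hj
    have e1 : t.arr aElt i (t.reg rStop) = D.code (D.el i (t.reg rStop)) := by
      rw [ha _ (by decide), hs.arrElt i hi _ hlt']
    have e2 : t.arr aElt j (t.reg rPos) = D.code (D.el j (t.reg rPos)) := by
      rw [ha _ (by decide), hs.arrElt j hj _ (hp.trans_lt hfl)]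
    have e3 := hs.arrLess (D.el j (t.reg rPos)) (D.el i (t.reg rStop))
    rw [← ha _ (by decide)] at e3
    simp only [Runs.seq_iff, Runs.load_iff]
    simp [hI', hK', e1, e2]
    by_cases hb : D.el j (t.reg rPos) < D.el i (t.reg rStop)
    · refine Runs.ifLt_true ?_ ?_
      · simpa [hZ] using e3.2 hb
      · simp
        refine ⟨N - 1, by omega, by omega, hf, ho, ha, hold, hnew, fun a h1 h2 => ?_⟩
        -- The entry for `a` is not the current position, whose element is below `el i a`.
        refine Nat.succ_le_of_lt ((hle a h1 h2).lt_of_ne fun h => ?_)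
        refine not_lt_firstNotBelow hi h2 hj (h ▸ ?_)
        exact hb.trans_le (el_le hi h1 h2)
    · refine Runs.ifLt_false ?_ ?_
      · simpa [hZ] using mt e3.1 hb
      · have hval : t.reg rPos = firstNotBelow (D.el j) (D.el i (t.reg rStop)) :=
          le_antisymm hp (firstNotBelow_le hb)
        simp [hK']
        refine ⟨N - 1, by omega, by omega, hf, ho, ?_, ?_, ?_, ?_⟩
        · intro a ha'
          ext
          simp [ha', ha a ha']
        · exact fun x l h => TableEntry.setArr hval (.inr (hold x l h))
        · intro a h
          refine TableEntry.setArr hval ?_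
          rcases h.eq_or_lt with rfl | h
          exacts [.inl ⟨rfl, rfl⟩, .inr (hnew a h)]
        · exact fun a h1 h2 => hle a (by omega) h2
  · simp [hStop, hPos, EqOff.refl]
  · rintro t c ⟨hc, hlt, N, -, hf, ho, ha, hold, hnew, -⟩
    rw [hf rLen (by decide), hLen, not_lt] at hlt
    exact ⟨hc, hf, ho, ha, hold, fun a h => hnew a (h.trans_le hlt)⟩

theorem table_runs {L : ℕ} (hs : D.Loaded s) (hL : ∀ i < D.n, D.len i ≤ L) :
    Runs tableProg s fun t c => c ≤ D.n * (D.n * (14 * L + 5) + 5) + 2 ∧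
      D.Loaded t ∧ D.Tabled t ∧ t.out = s.out := by
  simp only [tableProg, Runs.seq_iff, Runs.const_iff]
  refine (Runs.whileLt_of_invariant (fun N t => N + t.reg rI = D.n ∧ D.Loaded t ∧
      t.out = s.out ∧ ∀ i < t.reg rI, ∀ a < D.len i, ∀ j < D.n, D.TableEntry t (D.el i a) j)
    (D.n * (14 * L + 5) + 5) ?_ D.n _ ⟨by simp, ?_, by simp, by simp⟩).mono ?_
  · rintro N t ⟨hN, ht, ho, hrow⟩ hlt
    rw [ht.regN] at hlt
    obtain ⟨i, hi⟩ : ∃ i, t.reg rI = i := ⟨_, rfl⟩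
    rw [hi] at hlt hrow hN
    simp only [Runs.seq_iff, Runs.load_iff, Runs.const_iff]
    refine (Runs.whileLt_of_invariant (fun M u => M + u.reg rK = D.n ∧ D.Loaded u ∧
      u.out = s.out ∧ u.reg rI = i ∧ u.reg rLen = D.len i ∧
      (∀ x l, D.TableEntry t x l → D.TableEntry u x l) ∧
      ∀ a < D.len i, ∀ j < u.reg rK, D.TableEntry u (D.el i a) j)
      (14 * L + 5) ?_ D.n _ ?_).mono ?_
    · rintro M u ⟨hM, hu, hou, hI, hLen, hold, hnew⟩ hlt'
      rw [hu.regN] at hlt'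
      simp only [Runs.seq_iff, Runs.const_iff]
      refine (row_runs (D := D) (i := i) (j := u.reg rK) ?_ hlt hlt' ?_ ?_ ?_ ?_ ?_).mono ?_
      · exact hu.of_eq (by simp) (by simp) (by simp)
      all_goals try simp [hI, hLen]
      intro w c hc hf ho' ha hold' hnew'
      have h1 := hL i hlt
      have h2 := hL _ hlt'
      have hK : w.reg rK = u.reg rK := by rw [hf _ (by decide)]; simp
      have hI' : w.reg rI = u.reg rI := by rw [hf _ (by decide)]; simp
      refine ⟨by omega, M - 1, by omega, by omega, hu.of_eq ?_ ?_ ?_, ho'.trans hou, hI'.trans hI,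
        ?_, fun x l h => hold' x l (hold x l h), fun a h j hj => ?_⟩
      · simp [hf rN (by decide)]
      · simp [hf rZero (by decide)]
      · exact fun a h => ha a (by omega)
      · rw [hf _ (by decide)]; simp [hLen]
      · rw [hK] at hj
        rcases hj.eq_or_lt with rfl | hj
        exacts [hnew' a h, hold' _ _ (hnew a h j hj)]
    · simp [hi, ho, ht.regZero, ht.arrLen i hlt]
      exact ht.of_eq (by simp) (by simp) (by simp)
    · rintro u c ⟨hc, hlt', M, hM, hu, hou, hI, hLen, hold, hnew⟩
      rw [hu.regN, not_lt] at hlt'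
      simp [hI]
      refine ⟨by omega, N - 1, by omega, by omega, hu.of_eq (by simp) (by simp) (by simp), hou,
        fun i' hi' a h j hj => ?_⟩
      rcases hi'.eq_or_lt with rfl | hi'
      exacts [hnew a h j (hj.trans_le hlt'), hold _ _ (hrow i' hi' a h j hj)]
  · exact hs.of_eq (by simp) (by simp) (by simp)
  · rintro t c ⟨hc, hlt, N, hN, ht, ho, hrow⟩
    rw [ht.regN, not_lt] at hlt
    exact ⟨by omega, ht, fun i hi => hrow i (hi.trans_le hlt), ho⟩

theorem minPos_runs (hs : D.Ready k v s) (hk : k < D.n) (hv : D.IsPartial k v) :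
    Runs minPosProg s fun t c => c ≤ 6 * D.n + 3 ∧ D.Ready k v t ∧ t.out = s.out ∧
      t.reg rPos = D.minPos k v := by
  simp only [minPosProg, Runs.seq_iff, Runs.const_iff]
  refine (Runs.whileLt_of_invariant (fun N t => N + t.reg rI = k ∧ D.Ready k v t ∧
    t.out = s.out ∧ t.reg rPos = (Finset.range (t.reg rI)).sup fun i =>
      firstNotBelow (D.el k) (D.el i (v i))) 6 ?_ k _ ?_).mono ?_
  · rintro N t ⟨hN, ht, ho, hp⟩ hlt
    rw [ht.regK] at hlt
    have e1 := (ht.holds _ hlt).2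
    have e2 : t.arr aFirst (D.code (D.el (t.reg rI) (v (t.reg rI)))) k = _ :=
      ht.tabled _ (hlt.trans hk) _ (hv _ hlt).1 k hk
    simp only [Runs.seq_iff, Runs.load_iff]
    simp [ht.loaded.regZero, e1, ht.regK, e2]
    have hsup : (Finset.range (t.reg rI + 1)).sup
        (fun i => firstNotBelow (D.el k) (D.el i (v i))) =
        max (firstNotBelow (D.el k) (D.el (t.reg rI) (v (t.reg rI)))) (t.reg rPos) := by
      rw [Finset.range_add_one, Finset.sup_insert, ← hp]
    by_cases hb : t.reg rPos < firstNotBelow (D.el k) (D.el (t.reg rI) (v (t.reg rI)))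
    · refine Runs.ifLt_true (by simpa using hb) ?_
      simp
      refine ⟨N - 1, by omega, by omega, ⟨ht.loaded.of_eq (by simp) (by simp) (by simp),
        ht.tabled, ht.holds, by simpa using ht.regK⟩, ho, ?_⟩
      rw [hsup, max_eq_left hb.le]
    · refine Runs.ifLt_false (by simpa using hb) ?_
      simp
      refine ⟨N - 1, by omega, by omega, ⟨ht.loaded.of_eq (by simp) (by simp) (by simp),
        ht.tabled, ht.holds, by simpa using ht.regK⟩, ho, ?_⟩
      rw [hsup, max_eq_right (not_lt.1 hb)]
  · simp
    exact ⟨hs.loaded.of_eq (by simp) (by simp) (by simp), hs.tabled, hs.holds,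
      by simpa using hs.regK⟩
  · rintro t c ⟨hc, hlt, N, hN, ht, ho, hp⟩
    rw [ht.regK] at hlt
    have hI : t.reg rI = k := by omega
    exact ⟨by omega, ht, ho, by rw [hp, hI]; rfl⟩

theorem place_runs {b : ℕ} (hs : D.Ready k v s) (hk : k < D.n) (hb : b < D.len k)
    (hPos : s.reg rPos = b) :
    Runs placeProg s fun t c => c ≤ 4 ∧ D.Ready (k + 1) (Function.update v k b) t ∧
      t.out = s.out := by
  have e1 := hs.loaded.arrElt k hk b hb
  simp only [placeProg, Runs.seq_iff, Runs.store_iff, Runs.load_iff, Runs.incr_iff]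
  simp [hs.regK, hs.loaded.regZero, hPos, e1]
  refine ⟨hs.loaded.of_eq (by simp) (by simp) ?_, hs.tabled, ?_, by simp⟩
  · intro a ha
    ext
    simp [show a ≠ 4 by omega, show a ≠ 5 by omega]
  · intro i hi
    rcases Nat.lt_succ_iff_lt_or_eq.1 hi with hi | rfl
    · simpa [hi.ne] using hs.holds i hi
    · simp

/-- The vectors before the filled-up one are those that precede it already in their first `k`
entries. -/
theorem fill_runs {ws : List (ℕ → ℕ)} (hs : D.Ready k v s) (hk : k ≤ D.n)
    (hv : D.IsPartial k v) (hws : D.Lists ws fun w => LexLt k w v) :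
    Runs fillProg s fun t c => c ≤ D.n * (6 * D.n + 8) + 1 ∧ t.out = s.out ∧
      ∃ v', D.Ready D.n v' t ∧ D.IsPartial D.n v' ∧ D.Lists ws fun w => LexLt D.n w v' := by
  refine (Runs.whileLt_of_invariant (fun N t => t.out = s.out ∧ ∃ l v', N + l = D.n ∧
    D.Ready l v' t ∧ D.IsPartial l v' ∧ D.Lists ws fun w => LexLt l w v') (6 * D.n + 8) ?_
    (D.n - k) s ⟨rfl, k, v, by omega, hs, hv, hws⟩).mono ?_
  · rintro N t ⟨ho, l, v', hN, ht, hv', hl⟩ hlt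
    rw [ht.regK, ht.loaded.regN] at hlt
    rw [Runs.seq_iff]
    refine (minPos_runs ht hlt hv').mono ?_
    rintro t₁ c₁ ⟨hc₁, ht₁, ho₁, hp⟩
    have hv'' := hv'.update_minPos hlt
    have hb := (hv'' l l.lt_succ_self).1
    rw [Function.update_self] at hb
    refine (place_runs ht₁ hlt hb hp).mono ?_
    rintro t₂ c₂ ⟨hc₂, ht₂, ho₂⟩
    exact ⟨by omega, N - 1, by omega, ho₂.trans (ho₁.trans ho), l + 1, _, by omega, ht₂, hv'',
      hl.congr fun w hw => lexLt_update_minPos_iff hlt hw⟩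
  · rintro t c ⟨hc, hlt, N, ho, l, v', hN, ht, hv', hl⟩
    rw [ht.regK, ht.loaded.regN] at hlt
    obtain rfl : l = D.n := by omega
    refine ⟨hc.trans ?_, ho, v', ht, hv', hl⟩
    gcongr
    omega

theorem emit_runs (hs : D.Ready D.n v s) :
    Runs emitProg s fun t c => c ≤ D.n * 4 + 2 ∧ D.Ready D.n v t ∧
      t.out = s.out ++ (List.range D.n).map fun i => D.code (D.el i (v i)) := by
  simp only [emitProg, Runs.seq_iff, Runs.const_iff]
  refine (Runs.whileLt_of_invariant (fun N t => N + t.reg rI = D.n ∧ D.Ready D.n v t ∧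
    t.out = s.out ++ (List.range (t.reg rI)).map fun i => D.code (D.el i (v i))) 4 ?_
    D.n _ ?_).mono ?_
  · rintro N t ⟨hN, ht, ho⟩ hlt
    rw [ht.loaded.regN] at hlt
    have e1 := (ht.holds _ hlt).2
    simp only [Runs.seq_iff, Runs.load_iff, Runs.emit_iff, Runs.incr_iff]
    simp [ht.loaded.regZero, e1]
    refine ⟨N - 1, by omega, by omega, ⟨ht.loaded.of_eq (by simp) (by simp) (by simp),
      ht.tabled, ht.holds, by simpa using ht.regK⟩, ?_⟩
    rw [List.range_succ, ho]
    simp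
  · simp
    exact ⟨hs.loaded.of_eq (by simp) (by simp) (by simp), hs.tabled, hs.holds,
      by simpa using hs.regK⟩
  · rintro t c ⟨hc, hlt, N, hN, ht, ho⟩
    rw [ht.loaded.regN] at hlt
    have hI : t.reg rI = D.n := by omega
    exact ⟨by omega, ht, by rw [ho, hI]⟩

theorem blocked_runs {b : ℕ} (hs : D.Ready k v s) (hk : k < D.n) (hb : b < D.len k)
    (hPos : s.reg rPos = b) :
    Runs blockedProg s fun t c => c ≤ D.n * 6 + 4 ∧ D.Ready k v t ∧ t.out = s.out ∧
      EqOff [rI, rElt, rFlag, rOther, rBit] s t ∧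
      (0 < t.reg rFlag ↔ ∃ i < k, D.el i (v i) < D.el k b) := by
  simp only [blockedProg, Runs.seq_iff, Runs.const_iff, Runs.load_iff]
  refine (Runs.whileLt_of_invariant (fun N t => N + t.reg rI = k ∧ D.Ready k v t ∧
    t.out = s.out ∧ EqOff [rI, rElt, rFlag, rOther, rBit] s t ∧
    t.reg rElt = D.code (D.el k b) ∧
    (0 < t.reg rFlag ↔ ∃ i < t.reg rI, D.el i (v i) < D.el k b)) 6 ?_ k _ ?_).mono ?_
  · rintro N t ⟨hN, ht, ho, hf, hx, hp⟩ hlt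
    rw [ht.regK] at hlt
    have e1 := (ht.holds _ hlt).2
    have e2 := ht.loaded.arrLess (D.el (t.reg rI) (v (t.reg rI))) (D.el k b)
    simp only [Runs.seq_iff, Runs.load_iff]
    simp [ht.loaded.regZero, e1, hx]
    -- The rest of the round changes neither the arrays nor `rK`.
    have hR : ∀ {u : RamState}, u.arr = t.arr → EqOff [rI, rElt, rFlag, rOther, rBit] t u →
        D.Ready k v u := fun {u} hu hf => by
      refine ⟨ht.loaded.of_eq (hf _ (by decide)) (hf _ (by decide)) fun a _ => by rw [hu], ?_, ?_,
        (hf _ (by decide)).trans ht.regK⟩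
      · simpa only [Tabled, TableEntry, hu] using ht.tabled
      · simpa only [Holds, hu] using ht.holds
    by_cases hlt' : D.el (t.reg rI) (v (t.reg rI)) < D.el k b
    · refine Runs.ifLt_true (by simpa [ht.loaded.regZero] using e2.2 hlt') ?_
      simp
      exact ⟨N - 1, by omega, by omega, hR rfl (by simp [EqOff.refl]), ho, hf, hx, _,
        le_rfl, hlt'⟩
    · refine Runs.ifLt_false (by simpa [ht.loaded.regZero] using mt e2.1 hlt') ?_
      simp
      refine ⟨N - 1, by omega, by omega, hR rfl (by simp [EqOff.refl]), ho, hf, hx, ?_⟩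
      rw [hp]
      constructor
      · rintro ⟨i, hi, h⟩
        exact ⟨i, by omega, h⟩
      · rintro ⟨i, hi, h⟩
        rcases hi.eq_or_lt with rfl | hi
        exacts [absurd h hlt', ⟨i, hi, h⟩]
  · simp [EqOff.refl, hPos, hs.regK, hs.loaded.arrElt k hk b hb]
    exact ⟨hs.loaded.of_eq (by simp) (by simp) (by simp), hs.tabled, hs.holds,
      by simpa using hs.regK⟩
  · rintro t c ⟨hc, hlt, N, hN, ht, ho, hf, -, hp⟩
    rw [ht.regK] at hlt
    have hI : t.reg rI = k := by omega
    exact ⟨by omega, ht, ho, hf, by rw [hp, hI]⟩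

/-- While entries are discarded, the vectors listed so far are those whose first `k` entries precede
or equal those of `v`; incrementing an entry turns this into strict precedence. If no entry is
left, this is the set of all vectors. -/
theorem retreat_runs {ws : List (ℕ → ℕ)} (hs : D.Ready D.n v s) (hv : D.IsPartial D.n v)
    (hws : D.Lists ws fun w => LexLe D.n w v) :
    Runs retreatProg s fun t c => c ≤ D.n * (6 * D.n + 16) + 2 ∧ t.out = s.out ∧
      ∃ k v', k ≤ D.n ∧ D.Ready k v' t ∧ D.IsPartial k v' ∧
        (k = 0 → D.Lists ws fun _ => True) ∧ (0 < k → D.Lists ws fun w => LexLt k w v') := by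
  simp only [retreatProg, Runs.seq_iff, Runs.const_iff]
  refine (Runs.whileLt_of_invariant (fun N t => t.out = s.out ∧
    ∃ l v', l ≤ D.n ∧ D.Ready l v' t ∧ D.IsPartial l v' ∧
      (t.reg rStop = 0 ∧ N = l ∧ (D.Lists ws fun w => LexLe l w v') ∨
        t.reg rStop = l ∧ 0 < l ∧ D.Lists ws fun w => LexLt l w v'))
    (6 * D.n + 16) ?_ D.n _ ⟨by simp, D.n, v, le_rfl, ?_, hv, .inl ⟨by simp, rfl, hws⟩⟩).mono ?_
  · rintro N t ⟨ho, l, v', hl, ht, hv', hcase⟩ hlt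
    rw [ht.regK] at hlt
    obtain ⟨h0, rfl, hL⟩ : t.reg rStop = 0 ∧ N = l ∧ D.Lists ws fun w => LexLe l w v' := by
      rcases hcase with h | h
      exacts [h, absurd hlt (by omega)]
    obtain ⟨k, rfl⟩ : ∃ k, N = k + 1 := ⟨N - 1, by omega⟩
    have hk : k < D.n := hl
    simp only [Runs.seq_iff, Runs.load_iff, Runs.decr_iff, Runs.incr_iff]
    simp [ht.regK, ht.loaded.regZero, (ht.holds k k.lt_succ_self).1, ht.loaded.arrLen k hk]
    -- The state in which the test for chain `k` starts.
    set t₁ := (((t.setReg 4 k).setReg 5 (v' k)).setReg 5 (v' k + 1)).setReg 9 (D.len k) with ht₁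
    have hR : D.Ready k v' t₁ := ⟨ht.loaded.of_eq (by simp [ht₁]) (by simp [ht₁]) (by simp [ht₁]),
      ht.tabled, ht.holds.mono k.le_succ, by simp [ht₁]⟩
    have key : Runs (ifLt rPos rLen blockedProg (const rFlag 1)) t₁ fun u c =>
        c ≤ 6 * D.n + 5 ∧ D.Ready k v' u ∧ u.out = t.out ∧ u.reg rPos = v' k + 1 ∧
        u.reg rStop = 0 ∧ (0 < u.reg rFlag ↔
          (v' k + 1 < D.len k → ∃ i < k, D.el i (v' i) < D.el k (v' k + 1))) := by
      by_cases hb : v' k + 1 < D.len k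
      · refine Runs.ifLt_true (by simpa [ht₁] using hb) ?_
        refine (blocked_runs hR hk hb (by simp [ht₁])).mono ?_
        rintro u c ⟨hc, hu, hou, hf, hp⟩
        refine ⟨by omega, hu, hou.trans (by simp [ht₁]), ?_, ?_, by simp [hp, hb]⟩
        · rw [hf _ (by decide)]; simp [ht₁]
        · rw [hf _ (by decide)]; simp [ht₁, h0]
      · refine Runs.ifLt_false (by simpa [ht₁] using hb) ?_
        rw [Runs.const_iff]
        exact ⟨by omega, ⟨hR.loaded.of_eq (by simp) (by simp) (by simp), hR.tabled, hR.holds,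
          by simpa using hR.regK⟩, by simp [ht₁], by simp [ht₁], by simp [ht₁, h0],
          by simp [hb]⟩
    refine key.mono ?_
    rintro u c ⟨hc, hu, hou, hPos, hStop, hflag⟩
    by_cases hb : 0 < u.reg rFlag
    · refine Runs.ifLt_true (by simpa [hu.loaded.regZero] using hb) ?_
      rw [Runs.skip_iff]
      exact ⟨by omega, k, by omega, hou.trans ho, k, hk.le, v', hu, hv'.mono k.le_succ,
        .inl ⟨hStop, rfl, hL.congr fun w hw =>
          (lexLe_succ_iff_of_blocked hk hw (hflag.1 hb)).symm⟩⟩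
    · refine Runs.ifLt_false (by simpa [hu.loaded.regZero] using hb) ?_
      have hb' := mt hflag.2 hb
      push Not at hb'
      obtain ⟨hlen, hinc⟩ := hb'
      rw [Runs.seq_iff]
      refine (place_runs hu hk hlen hPos).mono ?_
      rintro z d ⟨hd, hz, hoz⟩
      rw [Runs.copy_iff]
      exact ⟨by omega, 0, by omega, by simp [hoz, hou, ho], k + 1, hl, _,
        ⟨hz.loaded.of_eq (by simp) (by simp) (by simp), hz.tabled, hz.holds,
          by simpa using hz.regK⟩, hv'.update_succ hk hlen hinc,
        .inr ⟨by simpa using hz.regK, k.succ_pos, hL.congr fun w _ => lexLt_update_succ_iff⟩⟩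
  · exact ⟨hs.loaded.of_eq (by simp) (by simp) (by simp), hs.tabled, hs.holds,
      by simpa using hs.regK⟩
  · rintro t c ⟨hc, hlt, N, ho, l, v', hl, ht, hv', hcase⟩
    rw [ht.regK] at hlt
    refine ⟨by omega, ho, l, v', hl, ht, hv', ?_, ?_⟩
    · rintro rfl
      rcases hcase with ⟨-, -, h⟩ | ⟨-, h, -⟩
      · exact h.congr fun w _ => by simp [LexLe, AgreeBelow]
      · exact absurd h (lt_irrefl _)
    · intro hpos
      rcases hcase with ⟨h, -⟩ | ⟨-, -, h⟩
      exacts [absurd hlt (by omega), h]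

/-- `L` bounds the lengths of the chains and the number of vectors to be listed, so
`L - ws.length` bounds the number of the rounds still to come when `ws` has been listed. -/
theorem enum_runs {L : ℕ} (hs : D.Loaded s) (ho : s.out = []) (hlen : ∀ i < D.n, D.len i ≤ L)
    (hlists : ∀ ws S, D.Lists ws S → ws.length ≤ L) :
    Runs enumProg s fun t c => c ≤ 100 * (D.n ^ 2 * L) ∧ ∃ ws, (D.Lists ws fun _ => True) ∧
      t.out = ws.flatMap fun w => (List.range D.n).map fun i => D.code (D.el i (w i)) := by
  have hn := D.n_pos
  obtain ⟨b, hb, -⟩ := D.extend 0 hn (fun _ => 0) (by simp)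
  have hb : 0 < D.len 0 := by omega
  have hLpos : 0 < L := hb.trans_le (hlen 0 hn)
  simp only [enumProg, Runs.seq_iff]
  refine (table_runs hs hlen).mono ?_
  rintro t₁ c₁ ⟨hc₁, hs₁, htab, ho₁⟩
  simp only [Runs.const_iff]
  have hR : D.Ready 0 (fun _ => 0) ((t₁.setReg rPos 0).setReg rK 0) :=
    ⟨hs₁.of_eq (by simp) (by simp) (by simp), htab, by simp [Holds], by simp⟩
  refine (place_runs hR hn hb (by simp)).mono ?_
  rintro t₂ c₂ ⟨hc₂, ht₂, ho₂⟩
  have hv : D.IsPartial 1 (Function.update (fun _ => 0) 0 0) :=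
    IsPartial.update (by simp [IsPartial]) hb (by simp)
  refine (Runs.whileLt_of_invariant (fun N t => ∃ ws, N + ws.length = L ∧
    (t.out = ws.flatMap fun w => (List.range D.n).map fun i => D.code (D.el i (w i))) ∧
    ∃ k v', k ≤ D.n ∧ D.Ready k v' t ∧ D.IsPartial k v' ∧
        (k = 0 → D.Lists ws fun _ => True) ∧ (0 < k → D.Lists ws fun w => LexLt k w v'))
    (D.n * (12 * D.n + 28) + 6) ?_ L _
    ⟨[], by simp, ?_, 1, _, hn, ht₂, hv, by simp, fun _ => ⟨.nil, by simp, ?_⟩⟩).mono ?_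
  · rintro N t ⟨ws, hN, ho, k, v, hk, ht, hv, -, hws⟩ hlt
    rw [ht.loaded.regZero, ht.regK] at hlt
    simp only [Runs.seq_iff]
    refine (fill_runs ht hk hv (hws hlt)).mono ?_
    rintro t₁ c₁ ⟨hc₁, ho₁, v', ht₁, hv', hws₁⟩
    refine (emit_runs ht₁).mono ?_
    rintro t₂ c₂ ⟨hc₂, ht₂, ho₂⟩
    have hws₂ := hws₁.concat hv'
    have hlen' := hlists _ _ hws₂
    rw [List.length_append, List.length_singleton] at hlen'
    refine (retreat_runs ht₂ hv' hws₂).mono ?_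
    rintro t₃ c₃ ⟨hc₃, ho₃, k', v'', h⟩
    refine ⟨by linarith, N - 1, by omega, ws ++ [v'], ?_, ?_, k', v'', h⟩
    · rw [List.length_append, List.length_singleton]
      omega
    · rw [ho₃, ho₂, ho₁, ho]
      simp
  · rw [ho₂]
    simp [ho₁, ho]
  · intro w hw h
    obtain ⟨j, hj, hlt, -⟩ := h
    obtain rfl : j = 0 := by omega
    simp at hlt
  · rintro t c ⟨hc, hlt, N, ws, hN, ho, k, v, hk, ht, hv, hfin, -⟩
    rw [ht.loaded.regZero, ht.regK] at hlt
    refine ⟨?_, ws, hfin (by omega), ho⟩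
    have h1 : D.n ≤ D.n ^ 2 * L := by nlinarith
    have h2 : D.n * L ≤ D.n ^ 2 * L := Nat.mul_le_mul_right _ (by nlinarith)
    have h3 : 1 ≤ D.n ^ 2 * L := by nlinarith
    have h4 : D.n ^ 2 ≤ D.n ^ 2 * L := by nlinarith
    have h5 : L ≤ D.n ^ 2 * L := by nlinarith
    nlinarith

end Enumeration

/-! ### Width-extensible posets -/

section Width

open ExtensibleChains

variable {X : Type u} [PartialOrder X]

namespace ChainPartition

variable {n : ℕ} (P : ChainPartition X n)

/-- The length of chain `i`, and `0` if there is no such chain. -/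
def length (i : ℕ) : ℕ := if h : i < n then P.len ⟨i, h⟩ else 0

open Classical in
/-- The element at position `a` of chain `i`, and an arbitrary one if there is no such position. -/
noncomputable def elem [Nonempty X] (i a : ℕ) : X :=
  if h : ∃ hi : i < n, a < P.len ⟨i, hi⟩ then P.state ⟨i, h.1⟩ ⟨a, h.2⟩
  else Classical.arbitrary X

variable {P}

theorem length_of_lt {i : ℕ} (h : i < n) : P.length i = P.len ⟨i, h⟩ := dif_pos h

variable [Nonempty X]

theorem elem_of_lt {i a : ℕ} (h : i < n) (ha : a < P.len ⟨i, h⟩) :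
    P.elem i a = P.state ⟨i, h⟩ ⟨a, ha⟩ := dif_pos ⟨h, ha⟩

theorem elem_lt {i a b : ℕ} (h : i < n) (hab : a < b) (hb : b < P.length i) :
    P.elem i a < P.elem i b := by
  rw [length_of_lt h] at hb
  rw [elem_of_lt h hb, elem_of_lt h (hab.trans hb)]
  exact P.strictMono _ hab

theorem exists_elem_eq (x : X) : ∃ i < n, ∃ a < P.length i, P.elem i a = x := by
  obtain ⟨⟨i, a⟩, rfl⟩ := P.bijective.2 x
  exact ⟨i, i.2, a, by rw [length_of_lt i.2]; exact a.2, elem_of_lt i.2 a.2⟩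

theorem elem_index_inj {i j a b : ℕ} (hi : i < n) (ha : a < P.length i) (hj : j < n)
    (hb : b < P.length j) (h : P.elem i a = P.elem j b) : i = j := by
  rw [length_of_lt hi] at ha
  rw [length_of_lt hj] at hb
  rw [elem_of_lt hi ha, elem_of_lt hj hb] at h
  have := P.bijective.1 (a₁ := ⟨⟨i, hi⟩, ⟨a, ha⟩⟩) (a₂ := ⟨⟨j, hj⟩, ⟨b, hb⟩⟩) h
  exact congrArg (fun p => (p.1 : ℕ)) this

theorem eq_of_not_lt {i a b : ℕ} (hi : i < n) (ha : a < P.length i) (hb : b < P.length i)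
    (h : ¬ P.elem i a < P.elem i b) (h' : ¬ P.elem i b < P.elem i a) : a = b := by
  rcases lt_trichotomy a b with hab | hab | hab
  exacts [absurd (elem_lt hi hab hb) h, hab, absurd (elem_lt hi hab ha) h']

theorem eq_of_mem_antichain {A : Finset X} (hA : IsAntichain (· ≤ ·) (A : Set X)) {i a b : ℕ}
    (hi : i < n) (ha : a < P.length i) (hb : b < P.length i) (h : P.elem i a ∈ A)
    (h' : P.elem i b ∈ A) : a = b :=
  eq_of_not_lt hi ha hb (fun hlt => hA h h' hlt.ne hlt.le) fun hlt => hA h' h hlt.ne hlt.le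

/-- An antichain with as many elements as there are chains meets every chain. -/
theorem exists_mem_of_card_eq {A : Finset X} (hA : IsAntichain (· ≤ ·) (A : Set X))
    (hcard : A.card = n) {j : ℕ} (hj : j < n) : ∃ b < P.length j, P.elem j b ∈ A := by
  choose f hf g hg hfg using P.exists_elem_eq
  have hinj : Set.InjOn f A := by
    intro x hx y hy hxy
    have hgx := hg x
    rw [← hfg x, ← hfg y, ← hxy]
    rw [← hfg x] at hx
    rw [← hfg y, ← hxy] at hy
    rw [eq_of_mem_antichain hA (hf x) (hg x) (hxy ▸ hg y) hx hy]
  have hsurj : Set.SurjOn f A (Finset.range n : Finset ℕ) :=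
    Finset.surjOn_of_injOn_of_card_le f (fun x _ => Finset.mem_coe.2 (Finset.mem_range.2 (hf x)))
      hinj (by simp [hcard])
  obtain ⟨x, hx, rfl⟩ := hsurj (Finset.mem_coe.2 (Finset.mem_range.2 hj))
  exact ⟨g x, hg x, by rwa [hfg]⟩

variable [Fintype X]

theorem posetWidth_pos : 0 < posetWidth X := by
  classical
  obtain ⟨x⟩ := ‹Nonempty X›
  exact Nat.lt_of_lt_of_le Nat.one_pos
    (Finset.le_sup (f := Finset.card) (b := ({x} : Finset X)) (by simp))

/-- A partition of a width-extensible poset into as few chains as possible. An antichain is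
prolonged to a further chain by the element of that chain in a width-antichain containing it. -/
noncomputable def toExtensibleChains (P : ChainPartition X (posetWidth X))
    (hX : WidthExtensible X) (num : X ≃ Fin (Fintype.card X)) : ExtensibleChains X where
  n := posetWidth X
  len := P.length
  el := P.elem
  code x := num x
  n_pos := posetWidth_pos
  code_injective := Fin.val_injective.comp num.injective
  el_lt _ hi _ _ hab hb := elem_lt hi hab hb
  exists_not_lt i hi a ha j hj := by
    obtain ⟨W, hW, hsub⟩ := hX {P.elem i a} (by simp)
    obtain ⟨b, hb, hmem⟩ := exists_mem_of_card_eq (P := P) hW.1 hW.2 hj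
    exact ⟨b, hb, fun hlt => hW.1 hmem (by simpa using hsub) hlt.ne hlt.le⟩
  extend k hk v hv := by
    classical
    obtain ⟨W, hW, hsub⟩ := hX ((Finset.range k).image fun i => P.elem i (v i)) (by
      intro x hx y hy hne hle
      simp only [Finset.coe_image, Set.mem_image, Finset.coe_range, Set.mem_Iio] at hx hy
      obtain ⟨i, hi, rfl⟩ := hx
      obtain ⟨j, hj, rfl⟩ := hy
      exact (hv i hi).2 j hj (hle.lt_of_ne hne))
    obtain ⟨b, hb, hmem⟩ := exists_mem_of_card_eq (P := P) hW.1 hW.2 hk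
    have hmem' : ∀ i < k, P.elem i (v i) ∈ W := fun i hi =>
      hsub (Finset.mem_image.2 ⟨i, Finset.mem_range.2 hi, rfl⟩)
    exact ⟨b, hb, fun i hi => ⟨fun hlt => hW.1 (hmem' i hi) hmem hlt.ne hlt.le,
      fun hlt => hW.1 hmem (hmem' i hi) hlt.ne hlt.le⟩⟩

variable {P : ChainPartition X (posetWidth X)} {hX : WidthExtensible X}
  {num : X ≃ Fin (Fintype.card X)} {v w : ℕ → ℕ}

local notation "𝓓" => toExtensibleChains P hX num

theorem loaded_ramInput : (𝓓).Loaded (ramInput num P) where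
  regN := rfl
  regZero := rfl
  arrElt i hi a ha := by
    replace hi : i < posetWidth X := hi
    replace ha : a < P.length i := ha
    rw [length_of_lt hi] at ha
    simp [ramInput, hi, ha, toExtensibleChains, elem_of_lt hi ha]
  arrLess x y := by
    by_cases hxy : x < y <;> simp [ramInput, toExtensibleChains, hxy]
  arrLen i hi := by
    replace hi : i < posetWidth X := hi
    simp [ramInput, hi, toExtensibleChains, length_of_lt hi]

variable (P) in
/-- The elements at the positions given by `w`, one in each chain. -/
noncomputable def elems (w : ℕ → ℕ) : List X :=
  (List.range (posetWidth X)).map fun i => P.elem i (w i)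

theorem mem_elems_iff (hw : (𝓓).IsPartial (𝓓).n w) {i b : ℕ} (hi : i < posetWidth X)
    (hb : b < P.length i) : P.elem i b ∈ P.elems w ↔ w i = b := by
  simp only [elems, List.mem_map, List.mem_range]
  constructor
  · rintro ⟨j, hj, h⟩
    obtain rfl := elem_index_inj hj (hw j hj).1 hi hb h
    refine eq_of_not_lt hi (hw j hj).1 hb ?_ ?_ <;> rw [h] <;> exact lt_irrefl _
  · rintro rfl
    exact ⟨i, hi, rfl⟩

theorem nodup_elems (hw : (𝓓).IsPartial (𝓓).n w) : (P.elems w).Nodup := by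
  refine List.Nodup.map_on (fun i hi j hj h => ?_) List.nodup_range
  rw [List.mem_range] at hi hj
  exact elem_index_inj hi (hw i hi).1 hj (hw j hj).1 h

open Classical in
theorem isWidthAntichain_elems (hw : (𝓓).IsPartial (𝓓).n w) :
    IsWidthAntichain (P.elems w).toFinset := by
  constructor
  · intro x hx y hy hne hle
    simp only [elems, List.coe_toFinset, List.mem_map, List.mem_range, Set.mem_ofPred_eq] at hx hy
    obtain ⟨i, hi, rfl⟩ := hx
    obtain ⟨j, hj, rfl⟩ := hy
    exact (hw i hi).2 j hj (hle.lt_of_ne hne)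
  · rw [List.toFinset_card_of_nodup (nodup_elems hw)]
    simp [elems]

open Classical in
theorem agreeBelow_of_toFinset_elems_eq (hw : (𝓓).IsPartial (𝓓).n w)
    (hv : (𝓓).IsPartial (𝓓).n v) (h : (P.elems w).toFinset = (P.elems v).toFinset) :
    AgreeBelow (𝓓).n w v := by
  intro i hi
  rw [← mem_elems_iff hw hi (hv i hi).1, ← List.mem_toFinset, h, List.mem_toFinset,
    mem_elems_iff hv hi (hv i hi).1]

open Classical in
theorem exists_toFinset_elems_eq {A : Finset X} (hA : IsWidthAntichain A) :
    ∃ w, (𝓓).IsPartial (𝓓).n w ∧ (P.elems w).toFinset = A := by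
  have h : ∀ i, ∃ b, i < posetWidth X → b < P.length i ∧ P.elem i b ∈ A := fun i => by
    by_cases hi : i < posetWidth X
    · obtain ⟨b, hb⟩ := exists_mem_of_card_eq (P := P) hA.1 hA.2 hi
      exact ⟨b, fun _ => hb⟩
    · exact ⟨0, fun h => absurd h hi⟩
  choose w hw using h
  have hpart : (𝓓).IsPartial (𝓓).n w := fun i hi => ⟨(hw i hi).1, fun j hj hlt =>
    hA.1 (hw i hi).2 (hw j hj).2 hlt.ne hlt.le⟩
  refine ⟨w, hpart, Finset.eq_of_subset_of_card_le (fun x hx => ?_) ?_⟩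
  · simp only [elems, List.mem_toFinset, List.mem_map, List.mem_range] at hx
    obtain ⟨i, hi, rfl⟩ := hx
    exact (hw i hi).2
  · rw [hA.2, (isWidthAntichain_elems hpart).2]

open Classical in
theorem nodup_map_toFinset_elems {ws : List (ℕ → ℕ)} {S : (ℕ → ℕ) → Prop}
    (h : (𝓓).Lists ws S) : (ws.map fun w => (P.elems w).toFinset).Nodup := by
  rw [List.Nodup, List.pairwise_map]
  refine h.sorted.imp_of_mem fun hw hv hlt heq => ?_
  exact hlt.not_agreeBelow (agreeBelow_of_toFinset_elems_eq (h.valid _ hw).1 (h.valid _ hv).1 heq)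

theorem length_le_numWidthAntichains {ws : List (ℕ → ℕ)} {S : (ℕ → ℕ) → Prop}
    (h : (𝓓).Lists ws S) : ws.length ≤ numWidthAntichains X := by
  classical
  rw [← List.length_map (f := fun w => (P.elems w).toFinset),
    ← List.toFinset_card_of_nodup (nodup_map_toFinset_elems h), numWidthAntichains,
    Nat.card_eq_fintype_card, Fintype.card_subtype]
  refine Finset.card_le_card fun A hA => ?_
  simp only [List.mem_toFinset, List.mem_map] at hA
  obtain ⟨w, hw, rfl⟩ := hA
  simpa using isWidthAntichain_elems (h.valid w hw).1

/-- Distinct elements of a chain lie in distinct width-antichains. -/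
theorem len_le_numWidthAntichains (P : ChainPartition X (posetWidth X)) (hX : WidthExtensible X)
    {i : ℕ} (hi : i < posetWidth X) : P.length i ≤ numWidthAntichains X := by
  choose W hW hsub using fun a => hX {P.elem i a} (by simp)
  have hmem : ∀ a, P.elem i a ∈ W a := fun a => by simpa using hsub a
  rw [numWidthAntichains, ← Nat.card_fin (P.length i)]
  refine Nat.card_le_card_of_injective (fun a : Fin (P.length i) => ⟨W a, hW a⟩) ?_
  intro a b hab
  have h : W a = W b := congrArg Subtype.val hab
  exact Fin.ext (eq_of_mem_antichain (hW a).1 hi a.2 b.2 (hmem a) (h ▸ hmem b))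

theorem enumeratesWidthAntichains {ws : List (ℕ → ℕ)} (h : (𝓓).Lists ws fun _ => True)
    {out : List ℕ} (hout : out = ws.flatMap fun w =>
      (List.range (𝓓).n).map fun i => (𝓓).code ((𝓓).el i (w i))) :
    EnumeratesWidthAntichains num out := by
  classical
  refine ⟨ws.map P.elems, ?_, ?_, ?_, fun A => ?_⟩
  · rw [hout, List.map_flatten, List.map_map, List.flatMap_def]
    congr 1
    refine List.map_congr_left fun w _ => ?_
    simp [elems, toExtensibleChains]
  · intro b hb
    obtain ⟨w, hw, rfl⟩ := List.mem_map.1 hb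
    exact nodup_elems (h.valid w hw).1
  · convert nodup_map_toFinset_elems h
    simp
  · rw [List.map_map, List.mem_map]
    constructor
    · rintro ⟨w, hw, rfl⟩
      convert isWidthAntichain_elems (h.valid w hw).1
      simp
    · intro hA
      obtain ⟨w, hw, rfl⟩ := exists_toFinset_elems_eq (P := P) (hX := hX) (num := num) hA
      obtain ⟨w', hw', hag⟩ := h.complete w hw trivial
      refine ⟨w', hw', ?_⟩
      have : P.elems w' = P.elems w := List.map_congr_left fun i hi => by
        rw [hag i (List.mem_range.1 hi)]
      simp [this]

end ChainPartition

end Width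

theorem mainTheorem10 :
    ∃ (p : RamProg) (C : ℕ),
      ∀ (X : Type u) [PartialOrder X] [Fintype X] [Nonempty X],
        WidthExtensible X →
        ∀ (num : X ≃ Fin (Fintype.card X)) (P : ChainPartition X (posetWidth X)),
          ∃ (final : RamState) (t : ℕ),
            RamExec p (ramInput num P) final t ∧
            EnumeratesWidthAntichains num final.out ∧
            t ≤ C * ((posetWidth X) ^ 2 * numWidthAntichains X) := by
  refine ⟨Enumeration.enumProg, 100, fun X _ _ _ hX num P => ?_⟩
  obtain ⟨t, c, he, hc, ws, hws, hout⟩ :=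
    Enumeration.enum_runs (ChainPartition.loaded_ramInput (P := P) (hX := hX) (num := num)) rfl
      (fun i hi => ChainPartition.len_le_numWidthAntichains P hX hi)
      (fun _ _ h => ChainPartition.length_le_numWidthAntichains h)
  exact ⟨t, c, he, ChainPartition.enumeratesWidthAntichains hws hout, hc⟩
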